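/- Let $d\in\mathbb{N}$ and let $\mathbf{A}\subseteq\mathbb{Z}^d$ be a finite set (a vector addition system, whose elements are called actions). Let $\star\notin\mathbb{Z}$ be an additional element, with $\star+z=z+\star=\star+\star=\star$ for $z\in\mathbb{Z}$. For $I\subseteq\{1,\dots,d\}$ let $\mathbb{N}_I^d$ be the set of vectors $\mathbf{c}\in(\mathbb{N}\cup\{\star\})^d$ with $I=\{i\mid \mathbf{c}(i)=\star\}$, and for $\mathbf{a}\in\mathbb{Z}^d$ let $\pi_I(\mathbf{a})$ be obtained from $\mathbf{a}$ by replacing the components indexed by $I$ by $\star$. A witness graph is a pair $G=(\mathbf{Q},T)$ in which, for some $I$, $\mathbf{Q}\subseteq\mathbb{N}_I^d$ is a non-empty finite set of states, $T\subseteq\mathbf{Q}\times\mathbf{A}\times\mathbf{Q}$ is a finite set of transitions with $\mathbf{y}=\mathbf{x}+\pi_I(\mathbf{a})$ for every $(\mathbf{x},\mathbf{a},\mathbf{y})\in T$, and the graph is strongly connected: between any two states there is a (possibly empty) path. The displacement $\Delta(\sigma)\in\mathbb{Z}^d$ of a word $\sigma=\mathbf{a}_1\cdots\mathbf{a}_k$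 of actions is $\sum_{j=1}^k\mathbf{a}_j$. The witness graph $G$ is reversible if for every path of $G$ from a state $\mathbf{x}$ to a state $\mathbf{y}$ labelled by a word $u$ there is a path of $G$ from $\mathbf{y}$ to $\mathbf{x}$ labelled by a word $v$ with $\Delta(u)+\Delta(v)=\mathbf{0}$. A Kirchhoff function for $G$ is a function $\mu:T\to\mathbb{N}$ such that, for every $\mathbf{x}\in\mathbf{Q}$, the sum of $\mu(t)$ over the transitions $t$ that enter $\mathbf{x}$ equals the sum of $\mu(t)$ over the transitions $t$ that leave $\mathbf{x}$; it is total if $\mu(t)\ge 1$ for every $t\in T$; its displacement is $\sum_{t=(\mathbf{x},\mathbf{a},\mathbf{y})\in T}\mu(t)\,\mathbf{a}\in\mathbb{Z}^d$; and $\|\mu\|_\infty=\max_{t\in T}\mu(t)$. Let $\|\mathbf{A}\|_\infty=\max_{\mathbf{a}\in\mathbf{A}}\max_{1\le i\le d}|\mathbf{a}(i)|$. A maximum over the empty set is $0$. **Theorem.** Let $G=(\mathbf{Q},T)$ be a reversible witness graph. Then the zero vector of $\mathbb{Z}^d$ is the displacement of a total Kirchhoff function $\mu$ for $G$ such that $$\|\mu\|_\infty\le\bigl(q(1+2a)\bigr)^{d(d+1)},$$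 where $q=|\mathbf{Q}|$ and $a=\|\mathbf{A}\|_\infty$. -/

import Mathlib

namespace VAS

/-- Vectors of `(ℤ ∪ {⋆})^d`; the element `⋆` is `⊤`, so that `⋆ + z = ⋆` and `z ≤ ⋆`. -/
abbrev ProjVec (d : ℕ) : Type := Fin d → WithTop ℤ

/-- Actions are vectors of `ℤ^d`. -/
abbrev Action (d : ℕ) : Type := Fin d → ℤ

/-- Configurations are vectors of `(ℕ ∪ {⋆})^d`, with `⋆ = ⊤`. -/
abbrev Config (d : ℕ) : Type := Fin d → WithTop ℕ

/-- The set `I` of projected components of a configuration: `c ∈ ℕ_I^d` iff `c.stars = I`. -/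
def Config.stars {d : ℕ} (c : Config d) : Finset (Fin d) :=
  Finset.univ.filter fun i => c i = ⊤

/-- The inclusion of `(ℕ ∪ {⋆})^d` into `(ℤ ∪ {⋆})^d`. -/
def Config.toProjVec {d : ℕ} (c : Config d) : ProjVec d :=
  fun i => (c i).map (fun n : ℕ => (n : ℤ))

/-- The projection `π_L` of a vector of `ℤ^d`, eliminating the components indexed by `L`. -/
def proj {d : ℕ} (L : Finset (Fin d)) (z : Action d) : ProjVec d :=
  fun i => if i ∈ L then ⊤ else (z i : WithTop ℤ)

/-- The one-action run from `x` to `y`: both lie in the same `ℕ_I^d`, and `y = x + π_I(a)`. -/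
def Step {d : ℕ} (x : Config d) (a : Action d) (y : Config d) : Prop :=
  y.stars = x.stars ∧ y.toProjVec = x.toProjVec + proj x.stars a

/-- The norm `‖z‖∞` of a vector of `ℤ^d` (equal to `0` if `d = 0`). -/
def vecNorm {d : ℕ} (z : Action d) : ℕ :=
  Finset.univ.sup fun i => (z i).natAbs

/-- The norm `‖A‖∞` of a finite set of vectors (equal to `0` if `A` is empty). -/
def setNorm {d : ℕ} (A : Finset (Action d)) : ℕ :=
  A.sup vecNorm

/-- A subreachability graph of the vector addition system `A`. -/
structure SubreachabilityGraph {d : ℕ} (A : Finset (Action d)) where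
  /-- the set of projected components -/
  I : Finset (Fin d)
  /-- the states -/
  Q : Finset (Config d)
  /-- the transitions -/
  T : Finset (Config d × Action d × Config d)
  Q_nonempty : Q.Nonempty
  Q_stars : ∀ x ∈ Q, x.stars = I
  T_subset : ∀ t ∈ T, t.1 ∈ Q ∧ t.2.1 ∈ A ∧ t.2.2 ∈ Q
  T_step : ∀ t ∈ T, Step t.1 t.2.1 t.2.2

namespace SubreachabilityGraph

variable {d : ℕ} {A : Finset (Action d)} (G : SubreachabilityGraph A)

/-- `G.Path x σ y`: there is a path from `x` to `y` in `G` labelled by the word `σ`. -/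
inductive Path : Config d → List (Action d) → Config d → Prop
  | nil (x : Config d) (hx : x ∈ G.Q) : Path x [] x
  | cons (x : Config d) (a : Action d) (y : Config d) (σ : List (Action d)) (z : Config d)
      (ht : (x, a, y) ∈ G.T) (hp : Path y σ z) : Path x (a :: σ) z

/-- A witness graph is a strongly connected subreachability graph. -/
def IsWitness : Prop :=
  ∀ x ∈ G.Q, ∀ y ∈ G.Q, ∃ σ, G.Path x σ y

/-- Every path can be followed by a path back such that the total displacement in `ℤ^d` is zero;
the displacement of a word is the sum of its actions. -/
def IsReversible : Prop :=
  ∀ x u y, G.Path x u y → ∃ v, G.Path y v x ∧ u.sum + v.sum = 0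

/-- The sum of `μ` over the transitions that enter `x`. -/
def inflow (μ : G.T → ℕ) (x : Config d) : ℕ :=
  ∑ t : G.T with t.1.2.2 = x, μ t

/-- The sum of `μ` over the transitions that leave `x`. -/
def outflow (μ : G.T → ℕ) (x : Config d) : ℕ :=
  ∑ t : G.T with t.1.1 = x, μ t

/-- Kirchhoff functions. -/
def IsKirchhoff (μ : G.T → ℕ) : Prop :=
  ∀ x ∈ G.Q, G.inflow μ x = G.outflow μ x

/-- A function on the transitions is total if all its values are positive. -/
def IsTotal (μ : G.T → ℕ) : Prop :=
  ∀ t, 1 ≤ μ t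

/-- The displacement of a function on the transitions, a vector of `ℤ^d`. -/
def displacement (μ : G.T → ℕ) : Action d :=
  ∑ t : G.T, μ t • t.1.2.1

/-- The norm `‖μ‖∞ = max_t μ(t)` (equal to `0` if there are no transitions). -/
def funNorm (μ : G.T → ℕ) : ℕ :=
  Finset.univ.sup μ

end SubreachabilityGraph

end VAS

namespace VAS

section Circulation

variable {E V : Type*} [Fintype E] [DecidableEq V] (src tgt : E → V)

/-- A function on the edges of a graph that satisfies Kirchhoff's law at every vertex. -/
def Balanced (μ : E → ℕ) : Prop :=
  ∀ x, ∑ e with tgt e = x, μ e = ∑ e with src e = x, μ e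

/-- An edge set whose indicator function is balanced and that leaves every vertex at most once,
that is, a disjoint union of simple cycles. -/
def IsCycleUnion [DecidableEq E] (P : Finset E) : Prop :=
  Balanced src tgt (fun e => if e ∈ P then 1 else 0) ∧ Set.InjOn src P

variable {src tgt}

theorem Balanced.sum {ι : Type*} (s : Finset ι) (μ : ι → E → ℕ)
    (h : ∀ j ∈ s, Balanced src tgt (μ j)) : Balanced src tgt (fun e => ∑ j ∈ s, μ j e) := by
  intro x
  rw [Finset.sum_comm, Finset.sum_comm (t := s)]
  exact Finset.sum_congr rfl fun j hj => h j hj x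

theorem Balanced.const_mul {μ : E → ℕ} (h : Balanced src tgt μ) (k : ℕ) :
    Balanced src tgt (fun e => k * μ e) := by
  intro x
  rw [← Finset.mul_sum, ← Finset.mul_sum, h x]

theorem exists_mem_periodicPts {α : Type*} [Finite α] [Nonempty α] (f : α → α) :
    ∃ x, x ∈ Function.periodicPts f := by
  obtain ⟨x⟩ := ‹Nonempty α›
  obtain ⟨m, n, hmn, h⟩ := Finite.exists_ne_map_eq_of_infinite (fun n : ℕ => f^[n] x)
  wlog hlt : m < n generalizing m n
  · exact this n m hmn.symm h.symm (by omega)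
  refine ⟨f^[m] x, n - m, by omega, ?_⟩
  rw [Function.IsPeriodicPt, Function.IsFixedPt, ← Function.iterate_add_apply,
    show n - m + m = n by omega]
  exact h.symm

/-- The support of a nonzero balanced function contains a nonempty union of disjoint cycles. -/
theorem Balanced.exists_isCycleUnion [DecidableEq E] {μ : E → ℕ} (h : Balanced src tgt μ) (hμ : ∃ e, 0 < μ e) :
    ∃ P : Finset E, P.Nonempty ∧ IsCycleUnion src tgt P ∧ ∀ e ∈ P, 0 < μ e := by
  classical
  have next : ∀ x, (∃ e, 0 < μ e ∧ tgt e = x) → ∃ e, 0 < μ e ∧ src e = x := by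
    rintro x ⟨e, he, hx⟩
    have hpos : 0 < ∑ e with src e = x, μ e := by
      rw [← h x]
      exact Finset.sum_pos' (fun _ _ => Nat.zero_le _) ⟨e, by simp [hx], he⟩
    by_contra! hcon
    refine hpos.ne' (Finset.sum_eq_zero fun e' he' => ?_)
    by_contra h0
    exact hcon e' (Nat.pos_of_ne_zero h0) (by simpa using he')
  obtain ⟨e₀, he₀⟩ := hμ
  have next' : ∀ x, ∃ e, 0 < μ e ∧ ((∃ e, 0 < μ e ∧ tgt e = x) → src e = x) := by
    intro x
    by_cases hx : ∃ e, 0 < μ e ∧ tgt e = x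
    · obtain ⟨e, h1, h2⟩ := next x hx
      exact ⟨e, h1, fun _ => h2⟩
    · exact ⟨e₀, he₀, fun h => absurd h hx⟩
  choose g hg hsrc using next'
  have hsrc' : ∀ e, 0 < μ e → src (g (tgt e)) = tgt e := fun e he => hsrc _ ⟨e, he, rfl⟩
  let f : E → E := fun e => g (tgt e)
  have : Nonempty E := ⟨e₀⟩
  obtain ⟨p, hp⟩ := exists_mem_periodicPts f
  have hbij := Function.bijOn_periodicPts f
  let P : Finset E := Finset.univ.filter (· ∈ Function.periodicPts f)
  have hP : ∀ e, e ∈ P ↔ e ∈ Function.periodicPts f := fun e => by simp [P]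
  have hpre : ∀ e ∈ P, ∃ e' ∈ P, f e' = e := fun e he => by
    obtain ⟨e', h1, h2⟩ := hbij.surjOn ((hP e).1 he)
    exact ⟨e', (hP e').2 h1, h2⟩
  have hpos : ∀ e ∈ P, 0 < μ e := fun e he => by
    obtain ⟨e', _, rfl⟩ := hpre e he
    exact hg _
  refine ⟨P, ⟨p, (hP p).2 hp⟩, ⟨fun x => ?_, fun e₁ h₁ e₂ h₂ h12 => ?_⟩, hpos⟩
  · rw [← Finset.sum_filter, ← Finset.sum_filter, Finset.sum_const, Finset.sum_const]
    congr 1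
    refine Finset.card_bij (fun e _ => f e) ?_ ?_ ?_
    · intro e he
      simp only [Finset.mem_filter, Finset.mem_univ, true_and] at he ⊢
      exact ⟨(hsrc' e (hpos e he.2)).trans he.1, (hP _).2 (hbij.mapsTo ((hP e).1 he.2))⟩
    · intro a ha b hb hab
      simp only [Finset.mem_filter, Finset.mem_univ, true_and] at ha hb
      exact hbij.injOn ((hP a).1 ha.2) ((hP b).1 hb.2) hab
    · intro e he
      simp only [Finset.mem_filter, Finset.mem_univ, true_and] at he
      obtain ⟨e', h1, h2⟩ := hpre e he.2
      refine ⟨e', ?_, h2⟩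
      simp only [Finset.mem_filter, Finset.mem_univ, true_and]
      exact ⟨by rw [← hsrc' e' (hpos e' h1), ← he.1, ← h2], h1⟩
  · have key : ∀ e ∈ P, g (src e) = e := fun e he => by
      obtain ⟨e', h1, h2⟩ := hpre e he
      rw [← h2]
      exact congrArg g (hsrc' e' (hpos e' h1))
    rw [← key e₁ h₁, ← key e₂ h₂, h12]

/-- A balanced function is a sum of indicator functions of unions of disjoint cycles. -/
theorem Balanced.exists_decomposition [DecidableEq E] {μ : E → ℕ} (h : Balanced src tgt μ) :
    ∃ n : Finset E → ℕ, (∀ P, n P ≠ 0 → IsCycleUnion src tgt P) ∧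
      ∀ e, μ e = ∑ P, n P * if e ∈ P then 1 else 0 := by
  classical
  induction hk : ∑ e, μ e using Nat.strong_induction_on generalizing μ with
  | _ k ih =>
  by_cases hμ : ∃ e, 0 < μ e
  · obtain ⟨P, hne, hP, hpos⟩ := h.exists_isCycleUnion hμ
    have hle : ∀ e, (if e ∈ P then 1 else 0) ≤ μ e := fun e => by
      split_ifs with he
      exacts [hpos e he, Nat.zero_le _]
    obtain ⟨ν, hν⟩ : ∃ ν : E → ℕ, ∀ e, μ e = ν e + if e ∈ P then 1 else 0 :=
      ⟨fun e => μ e - if e ∈ P then 1 else 0, fun e => (Nat.sub_add_cancel (hle e)).symm⟩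
    have hbal : Balanced src tgt ν := fun x => by
      have h1 := h x
      have h2 := hP.1 x
      simp only [hν, Finset.sum_add_distrib] at h1
      simp only at h2
      omega
    have hlt : ∑ e, ν e < k := by
      obtain ⟨e, he⟩ := hne
      rw [← hk]
      refine Finset.sum_lt_sum (fun e _ => by rw [hν e]; omega) ⟨e, Finset.mem_univ e, ?_⟩
      rw [hν e, if_pos he]
      omega
    obtain ⟨n, hn, hsum⟩ := ih _ hlt hbal rfl
    refine ⟨fun R => n R + if R = P then 1 else 0, fun R hR => ?_, fun e => ?_⟩
    · by_cases hRP : R = P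
      · exact hRP ▸ hP
      · exact hn R (by simpa [hRP] using hR)
    · rw [hν e, hsum e]
      simp only [add_mul, Finset.sum_add_distrib, ite_mul, one_mul, zero_mul,
        Finset.sum_ite_eq', Finset.mem_univ, if_true]
  · push Not at hμ
    exact ⟨0, fun P hP => absurd rfl hP, fun e => by simpa using hμ e⟩

end Circulation

section Relation

variable {ι : Type*} [Fintype ι] {d : ℕ}

/-- Among the nonnegative relations with a positive coefficient at `j₀`, one of minimal support
involves, apart from `j₀`, only linearly independent vectors. -/
theorem exists_relation_linearIndepOn (v : ι → Fin d → ℚ) (j₀ : ι) (n : ι → ℚ) (hn : ∀ j, 0 ≤ n j)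
    (hpos : 0 < n j₀) (hrel : ∑ j, n j • v j = 0) :
    ∃ m : ι → ℚ, (∀ j, 0 ≤ m j) ∧ 0 < m j₀ ∧ ∑ j, m j • v j = 0 ∧ (∀ j, n j = 0 → m j = 0) ∧
      LinearIndepOn ℚ v {j | m j ≠ 0 ∧ j ≠ j₀} := by
  classical
  induction hk : (Finset.univ.filter fun j => n j ≠ 0).card using Nat.strong_induction_on
    generalizing n with
  | _ k ih =>
  by_cases hli : LinearIndepOn ℚ v {j | n j ≠ 0 ∧ j ≠ j₀}
  · exact ⟨n, hn, hpos, hrel, fun _ h => h, hli⟩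
  obtain ⟨w, hw0, hwrel, j₁, hj₁⟩ : ∃ w : ι → ℚ, (∀ j, w j ≠ 0 → n j ≠ 0 ∧ j ≠ j₀) ∧
      ∑ j, w j • v j = 0 ∧ ∃ j, 0 < w j := by
    obtain ⟨w, hw0, hwrel, j₁, hj₁⟩ : ∃ w : ι → ℚ, (∀ j, w j ≠ 0 → n j ≠ 0 ∧ j ≠ j₀) ∧
        ∑ j, w j • v j = 0 ∧ ∃ j, w j ≠ 0 := by
      rw [linearIndepOn_iff] at hli
      push Not at hli
      obtain ⟨l, hl, hl0, hne⟩ := hli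
      refine ⟨l, fun j hj => hl (Finsupp.mem_support_iff.2 hj), ?_, ?_⟩
      · rw [← hl0, Finsupp.linearCombination_apply, Finsupp.sum_fintype _ _ (by simp)]
      · by_contra! hcon
        exact hne (Finsupp.ext hcon)
    rcases lt_or_gt_of_ne hj₁ with hlt | hgt
    · exact ⟨fun j => -w j, fun j hj => hw0 j (by simpa using hj),
        by simp [Finset.sum_neg_distrib, hwrel], j₁, by simpa using hlt⟩
    · exact ⟨w, hw0, hwrel, j₁, hgt⟩
  obtain ⟨j₂, hj₂, hmin⟩ := Finset.exists_min_image (Finset.univ.filter fun j => 0 < w j)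
    (fun j => n j / w j) ⟨j₁, by simpa using hj₁⟩
  simp only [Finset.mem_filter, Finset.mem_univ, true_and] at hj₂ hmin
  set c := n j₂ / w j₂ with hc
  have hc0 : 0 ≤ c := div_nonneg (hn _) hj₂.le
  have hwj₀ : w j₀ = 0 := by
    by_contra h
    exact (hw0 j₀ h).2 rfl
  have hzero : ∀ j, n j = 0 → n j - c * w j = 0 := fun j hj => by
    have : w j = 0 := by
      by_contra h
      exact (hw0 j h).1 hj
    rw [hj, this]; ring
  have hj₂0 : n j₂ - c * w j₂ = 0 := by
    rw [hc, div_mul_cancel₀ _ hj₂.ne', sub_self]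
  have hcard : (Finset.univ.filter fun j => n j - c * w j ≠ 0).card < k := by
    rw [← hk]
    refine Finset.card_lt_card ((Finset.ssubset_iff_of_subset ?_).2 ⟨j₂, ?_, ?_⟩)
    · intro j
      simp only [Finset.mem_filter, Finset.mem_univ, true_and]
      exact fun h h' => h (hzero j h')
    · simpa using (hw0 j₂ hj₂.ne').1
    · simpa using hj₂0
  have hnonneg : ∀ j, 0 ≤ n j - c * w j := fun j => by
    rcases lt_or_ge 0 (w j) with hj | hj
    · have := (le_div_iff₀ hj).1 (hmin j hj)
      linarith
    · have := mul_nonneg hc0 (neg_nonneg.2 hj)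
      have := hn j
      linarith
  have hrel' : ∑ j, (n j - c * w j) • v j = 0 := by
    simp only [sub_smul, mul_smul, Finset.sum_sub_distrib, ← Finset.smul_sum, hrel, hwrel,
      smul_zero, sub_zero]
  obtain ⟨m, h1, h2, h3, h4, h5⟩ := ih _ hcard (fun j => n j - c * w j) hnonneg
    (by simpa [hwj₀] using hpos) hrel' rfl
  exact ⟨m, h1, h2, h3, fun j hj => h4 j (hzero j hj), h5⟩

/-- Linearly independent vectors of `ℚ^d` extend by unit vectors to a basis. -/
theorem exists_basis_extension (v : ι → Fin d → ℚ) (s : Set ι) (hs : LinearIndepOn ℚ v s) :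
    ∃ k : Fin d → ι ⊕ Fin d, Function.Injective k ∧ (∀ j ∈ s, ∃ i, k i = Sum.inl j) ∧
      (∀ i j, k i = Sum.inl j → j ∈ s) ∧
      LinearIndependent ℚ fun i => Sum.elim v (fun l => Pi.single l (1 : ℚ)) (k i) := by
  classical
  set u : ι ⊕ Fin d → Fin d → ℚ := Sum.elim v (fun l => Pi.single l (1 : ℚ)) with hu
  have hs' : LinearIndepOn ℚ u (Sum.inl '' s) := by
    have : LinearIndepOn ℚ (u ∘ Sum.inl) s := hs
    exact this.image_of_comp
  obtain ⟨b, hb, hsb, hspan, hli⟩ := exists_linearIndepOn_extension hs'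
    (t := Sum.inl '' s ∪ Set.range Sum.inr) Set.subset_union_left
  have htop : Submodule.span ℚ (u '' b) = ⊤ := by
    rw [eq_top_iff, ← (Pi.basisFun ℚ (Fin d)).span_eq, Submodule.span_le]
    rintro _ ⟨i, rfl⟩
    refine hspan ⟨Sum.inr i, Or.inr ⟨i, rfl⟩, ?_⟩
    simp [hu]
  have hcard : Fintype.card b = d := by
    have hB := Module.finrank_eq_card_basis (Module.Basis.mk hli (by
      rw [← htop]; exact Submodule.span_mono (by rintro _ ⟨x, hx, rfl⟩; exact ⟨⟨x, hx⟩, rfl⟩)))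
    simpa using hB.symm
  let e : Fin d ≃ b := (Fintype.equivFinOfCardEq hcard).symm
  refine ⟨fun i => (e i : ι ⊕ Fin d), fun i j h => e.injective (Subtype.ext h),
    fun j hj => ?_, fun i j hij => ?_, ?_⟩
  · exact ⟨e.symm ⟨_, hsb ⟨j, hj, rfl⟩⟩, by simp⟩
  · have := hb (e i).2
    rw [show (e i : ι ⊕ Fin d) = Sum.inl j from hij] at this
    simpa using this
  · exact LinearIndependent.comp hli e e.injective

/-- A nonnegative relation between integer vectors whose entries are bounded by `M`, positive at
`j₀`, can be replaced by one with small integer coefficients. -/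
theorem exists_small_relation (v : ι → Fin d → ℤ) (M : ℕ) (hM : 1 ≤ M)
    (j₀ : ι) (n : ι → ℕ) (hv : ∀ j, n j ≠ 0 → ∀ i, |v j i| ≤ M) (hpos : n j₀ ≠ 0)
    (hrel : ∑ j, n j • v j = 0) :
    ∃ m : ι → ℕ, m j₀ ≠ 0 ∧ (∀ j, n j = 0 → m j = 0) ∧ ∑ j, m j • v j = 0 ∧
      ∑ j, m j ≤ (d + 1) * (d.factorial * M ^ d) := by
  classical
  obtain ⟨p, hp, hp₀, hprel, hpn, hli⟩ := exists_relation_linearIndepOn (fun j i => (v j i : ℚ)) j₀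
    (fun j => (n j : ℚ)) (fun j => Nat.cast_nonneg _) (by positivity) (by
      ext i
      have := congrFun hrel i
      simp only [Finset.sum_apply, nsmul_eq_mul, Pi.zero_apply] at this
      simp only [Finset.sum_apply, Pi.smul_apply, smul_eq_mul, Pi.zero_apply]
      exact_mod_cast this)
  have hpn' : ∀ j, p j ≠ 0 → n j ≠ 0 := fun j hj h => hj (hpn j (by simp [h]))
  obtain ⟨k, hkinj, hks, hks', hkli⟩ := exists_basis_extension _ _ hli
  let B : Matrix (Fin d) (Fin d) ℤ :=
    Matrix.of fun i l => Sum.elim v (fun l' => Pi.single l' (1 : ℤ)) (k l) i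
  let Bq : Matrix (Fin d) (Fin d) ℚ := B.map (Int.castRingHom ℚ)
  have hBcol : ∀ l, Bq.col l =
      Sum.elim (fun j i => (v j i : ℚ)) (fun l => Pi.single l (1 : ℚ)) (k l) := fun l => by
    ext i
    simp only [Bq, B, Matrix.col_apply, Matrix.map_apply, Matrix.of_apply]
    cases k l with
    | inl j => simp
    | inr j => simp [Pi.single_apply]
  have hBentry : ∀ i l, |B i l| ≤ M := fun i l => by
    simp only [B, Matrix.of_apply]
    rcases hkl : k l with j | j
    · exact hv j (hpn' j (hks' l j hkl).1) i
    · simp only [Sum.elim_inr, Pi.single_apply]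
      split_ifs
      · simpa using hM
      · simp
  have hdet : Bq.det ≠ 0 := by
    have : LinearIndependent ℚ Bq.col := by
      rw [show Bq.col = _ from funext hBcol]
      exact hkli
    exact ((Matrix.isUnit_iff_isUnit_det _).1
      (Matrix.linearIndependent_cols_iff_isUnit.1 this)).ne_zero
  have hdetB : (B.det : ℚ) = Bq.det := by
    have := RingHom.map_det (Int.castRingHom ℚ) B
    simpa [Bq] using this
  have hdetle : ∀ C : Matrix (Fin d) (Fin d) ℤ, (∀ i l, |C i l| ≤ M) →
      C.det.natAbs ≤ d.factorial * M ^ d := fun C hC => by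
    have := Matrix.det_le (A := C) (abv := AbsoluteValue.abs) (x := (M : ℤ)) hC
    simp only [Fintype.card_fin, nsmul_eq_mul, AbsoluteValue.abs_apply] at this
    zify
    exact this
  let y : Fin d → ℚ := fun l => Sum.elim p (fun _ => 0) (k l)
  have hBy : Bq.mulVec y = -p j₀ • fun i => (v j₀ i : ℚ) := by
    ext i
    let F : ι ⊕ Fin d → ℚ := Sum.elim (fun j => if j = j₀ then 0 else p j * v j i) fun _ => 0
    have h1 : Bq.mulVec y i = ∑ x, F x := by
      refine Fintype.sum_of_injective k hkinj _ _ (fun x hx => ?_) fun l => ?_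
      · rcases x with j | j
        · simp only [F, Sum.elim_inl]
          split_ifs with hj
          · rfl
          · have : p j = 0 := by
              by_contra h
              obtain ⟨l, hl⟩ := hks j ⟨h, hj⟩
              exact hx ⟨l, hl⟩
            rw [this, zero_mul]
        · rfl
      · have h2 : Bq i l = _ := congrFun (hBcol l) i
        change Bq i l * y l = _
        rw [h2]
        rcases hkl : k l with j | j
        · simp [F, y, hkl, (hks' l j hkl).2, mul_comm]
        · simp [F, y, hkl]
    have h3 : ∑ j, p j * (v j i : ℚ) = 0 := by
      have := congrFun hprel i
      simpa [Finset.sum_apply] using this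
    rw [h1, Fintype.sum_sum_type, Pi.smul_apply, smul_eq_mul]
    simp only [F, Sum.elim_inl, Sum.elim_inr, Finset.sum_const_zero, add_zero]
    rw [← Finset.add_sum_erase _ _ (Finset.mem_univ j₀)] at h3 ⊢
    rw [if_pos rfl, Finset.sum_congr rfl fun j hj => if_neg (Finset.ne_of_mem_erase hj)]
    linarith
  have hcramer : ∀ l, Bq.det * y l = -(p j₀ * (B.cramer (v j₀) l : ℤ)) := fun l => by
    have h1 : Bq.det • y = -p j₀ • Bq.cramer fun i => (v j₀ i : ℚ) := by
      rw [Matrix.cramer_eq_adjugate_mulVec, ← Matrix.mulVec_smul, ← hBy, Matrix.mulVec_mulVec,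
        Matrix.adjugate_mul, Matrix.smul_mulVec, Matrix.one_mulVec]
    have h2 : Bq.cramer (fun i => (v j₀ i : ℚ)) l = (B.cramer (v j₀) l : ℤ) := by
      rw [Matrix.cramer_apply, Matrix.cramer_apply]
      have h3 := RingHom.map_det (Int.castRingHom ℚ) (B.updateCol l (v j₀))
      rw [RingHom.mapMatrix_apply, Matrix.map_updateCol] at h3
      exact h3.symm
    have := congrFun h1 l
    simp only [Pi.smul_apply, smul_eq_mul] at this
    rw [this, h2]
    ring
  have hex : ∀ j, ∃ a : ℕ, a ≤ d.factorial * M ^ d ∧ (a : ℚ) = |Bq.det| / p j₀ * p j := fun j => by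
    by_cases hj₀ : j = j₀
    · refine ⟨B.det.natAbs, hdetle B hBentry, ?_⟩
      rw [Nat.cast_natAbs, hj₀, div_mul_cancel₀ _ hp₀.ne', Int.cast_abs, hdetB]
    by_cases hj : p j = 0
    · exact ⟨0, Nat.zero_le _, by simp [hj]⟩
    obtain ⟨l, hl⟩ := hks j ⟨hj, hj₀⟩
    refine ⟨(B.cramer (v j₀) l).natAbs, hdetle _ fun i l' => ?_, ?_⟩
    · rw [Matrix.updateCol_apply]
      split_ifs
      exacts [hv j₀ hpos i, hBentry i l']
    · have h1 := congrArg abs (hcramer l)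
      rw [abs_mul, abs_neg, abs_mul, abs_of_pos hp₀] at h1
      have h2 : y l = p j := by simp [y, hl]
      rw [h2, abs_of_nonneg (hp j)] at h1
      rw [Nat.cast_natAbs, Int.cast_abs, div_mul_eq_mul_div, h1, mul_div_cancel_left₀ _ hp₀.ne']
  choose m hmle hm using hex
  have hm0 : ∀ j, p j = 0 → m j = 0 := fun j hj => by
    have := hm j
    rw [hj, mul_zero] at this
    exact_mod_cast this
  refine ⟨m, fun h => ?_, fun j hj => hm0 j (hpn j (by simp [hj])), ?_, ?_⟩
  · have := hm j₀
    rw [h, div_mul_cancel₀ _ hp₀.ne', Nat.cast_zero] at this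
    exact hdet (abs_eq_zero.1 this.symm)
  · ext i
    have h3 : ∑ j, p j * (v j i : ℚ) = 0 := by
      have := congrFun hprel i
      simpa [Finset.sum_apply] using this
    have h4 : ∑ j, (m j : ℚ) * (v j i : ℚ) = 0 := by
      simp only [hm, mul_assoc, ← Finset.mul_sum, h3, mul_zero]
    simp only [Finset.sum_apply, nsmul_eq_mul, Pi.zero_apply]
    exact_mod_cast h4
  · let S : Finset ι := Finset.univ.filter fun j => p j ≠ 0
    have hS : (S.erase j₀).card ≤ d := by
      have : S.erase j₀ ⊆ Finset.univ.biUnion fun l : Fin d => (k l).elim singleton fun _ => ∅ := by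
        intro j hj
        obtain ⟨l, hl⟩ := hks j ⟨by simpa [S] using Finset.mem_of_mem_erase hj,
          Finset.ne_of_mem_erase hj⟩
        exact Finset.mem_biUnion.2 ⟨l, Finset.mem_univ l, by simp [hl]⟩
      refine (Finset.card_le_card this).trans (Finset.card_biUnion_le.trans ?_)
      refine (Finset.sum_le_card_nsmul _ _ 1 fun l _ => ?_).trans (by simp)
      rcases k l with j | j <;> simp
    have hS' : S.card ≤ d + 1 := by
      have := Finset.pred_card_le_card_erase (s := S) (a := j₀)
      omega
    calc ∑ j, m j = ∑ j ∈ S, m j := by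
          refine (Finset.sum_subset (Finset.subset_univ S) fun j _ hj => hm0 j ?_).symm
          simpa [S] using hj
      _ ≤ S.card • (d.factorial * M ^ d) := Finset.sum_le_card_nsmul _ _ _ fun j _ => hmle j
      _ ≤ _ := by
          rw [smul_eq_mul]
          exact Nat.mul_le_mul_right _ hS'

end Relation

theorem factorial_succ_mul_pow_le {d a q : ℕ} (hd : 1 ≤ d) (hq : 1 ≤ q) :
    q * (1 + 2 * a) ^ d * ((d + 1) * (d.factorial * (q * a) ^ d)) ≤
      (q * (1 + 2 * a)) ^ (d * (d + 1)) := by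
  have h1 : ∀ d : ℕ, (d + 1).factorial ≤ (d + 1) ^ d := fun d => by
    induction d with
    | zero => simp
    | succ d ih =>
      rw [Nat.factorial_succ, pow_succ']
      exact Nat.mul_le_mul_left _ (ih.trans (Nat.pow_le_pow_left (by omega) d))
  have h2 : (d + 1) * a ≤ (1 + 2 * a) ^ d := by
    have h := one_add_mul_le_pow (R := ℤ) (a := 2 * a) (by linarith [Int.natCast_nonneg a]) d
    zify
    have hd' : (1 : ℤ) ≤ d := by exact_mod_cast hd
    nlinarith [mul_nonneg (sub_nonneg.2 hd') (Int.natCast_nonneg a)]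
  have h3 : (d + 1).factorial * a ^ d ≤ (1 + 2 * a) ^ (d * d) := by
    calc (d + 1).factorial * a ^ d ≤ (d + 1) ^ d * a ^ d := Nat.mul_le_mul_right _ (h1 d)
      _ = ((d + 1) * a) ^ d := (mul_pow _ _ _).symm
      _ ≤ ((1 + 2 * a) ^ d) ^ d := Nat.pow_le_pow_left h2 d
      _ = _ := (pow_mul _ _ _).symm
  have h4 : q * q ^ d ≤ q ^ (d * (d + 1)) := by
    rw [← pow_succ']
    exact Nat.pow_le_pow_right hq (by nlinarith)
  calc q * (1 + 2 * a) ^ d * ((d + 1) * (d.factorial * (q * a) ^ d))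
      = (q * q ^ d) * ((1 + 2 * a) ^ d * ((d + 1).factorial * a ^ d)) := by
        rw [Nat.factorial_succ, mul_pow]; ring
    _ ≤ q ^ (d * (d + 1)) * ((1 + 2 * a) ^ d * (1 + 2 * a) ^ (d * d)) :=
        Nat.mul_le_mul h4 (Nat.mul_le_mul_left _ h3)
    _ = _ := by rw [← pow_add, mul_pow]; congr 2; ring

end VAS

namespace VAS

theorem Config.toProjVec_injective {d : ℕ} :
    Function.Injective (Config.toProjVec : Config d → ProjVec d) := fun x y h => by
  ext1 i
  exact WithTop.map_injective Nat.cast_injective (congrFun h i)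

theorem natAbs_le_setNorm {d : ℕ} {A : Finset (Action d)} {a : Action d} (ha : a ∈ A)
    (i : Fin d) : (a i).natAbs ≤ setNorm A :=
  (Finset.le_sup (f := fun i => (a i).natAbs) (Finset.mem_univ i)).trans
    (Finset.le_sup (f := vecNorm) ha)

theorem card_le_pow_setNorm {d : ℕ} (A : Finset (Action d)) :
    A.card ≤ (1 + 2 * setNorm A) ^ d := by
  have hsub : A ⊆ Fintype.piFinset fun _ : Fin d =>
      Finset.Icc (-(setNorm A : ℤ)) (setNorm A) := fun a ha => by
    rw [Fintype.mem_piFinset]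
    intro i
    have := natAbs_le_setNorm ha i
    rw [Finset.mem_Icc]
    omega
  refine (Finset.card_le_card hsub).trans (le_of_eq ?_)
  rw [Fintype.card_piFinset, Finset.prod_const, Int.card_Icc, Finset.card_univ, Fintype.card_fin]
  congr 1
  omega

namespace SubreachabilityGraph

variable {d : ℕ} {A : Finset (Action d)} (G : SubreachabilityGraph A)

theorem card_T_le : G.T.card ≤ G.Q.card * (1 + 2 * setNorm A) ^ d := by
  refine le_trans ?_ (Nat.mul_le_mul_left _ (card_le_pow_setNorm A))
  rw [← Finset.card_product]
  refine Finset.card_le_card_of_injOn (fun t => (t.1, t.2.1)) (fun t ht => ?_) ?_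
  · have := G.T_subset t ht
    simp [this.1, this.2.1]
  · rintro ⟨x, a, y⟩ h ⟨x', a', y'⟩ h' heq
    obtain ⟨rfl, rfl⟩ := Prod.mk.inj heq
    have : y = y' := Config.toProjVec_injective
      ((G.T_step _ h).2.trans (G.T_step _ h').2.symm)
    rw [this]

theorem isKirchhoff_of_balanced {μ : G.T → ℕ}
    (h : Balanced (fun t : G.T => t.1.1) (fun t : G.T => t.1.2.2) μ) : G.IsKirchhoff μ :=
  fun x _ => h x

theorem displacement_sum {ι : Type*} (s : Finset ι) (μ : ι → G.T → ℕ) :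
    G.displacement (fun t => ∑ j ∈ s, μ j t) = ∑ j ∈ s, G.displacement (μ j) := by
  simp only [displacement, Finset.sum_smul]
  exact Finset.sum_comm

theorem displacement_const_mul (k : ℕ) (μ : G.T → ℕ) :
    G.displacement (fun t => k * μ t) = k • G.displacement μ := by
  simp only [displacement, mul_smul, Finset.smul_sum]

theorem outflow_add_single (μ : G.T → ℕ) (t : G.T) (z : Config d) :
    G.outflow (μ + Pi.single t 1) z = G.outflow μ z + if z = t.1.1 then 1 else 0 := by
  simp only [outflow, Pi.add_apply, Finset.sum_add_distrib, Finset.sum_pi_single',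
    Finset.mem_filter, Finset.mem_univ, true_and, eq_comm]

theorem inflow_add_single (μ : G.T → ℕ) (t : G.T) (z : Config d) :
    G.inflow (μ + Pi.single t 1) z = G.inflow μ z + if z = t.1.2.2 then 1 else 0 := by
  simp only [inflow, Pi.add_apply, Finset.sum_add_distrib, Finset.sum_pi_single',
    Finset.mem_filter, Finset.mem_univ, true_and, eq_comm]

theorem displacement_add_single (μ : G.T → ℕ) (t : G.T) :
    G.displacement (μ + Pi.single t 1) = t.1.2.1 + G.displacement μ := by
  simp only [displacement, Pi.add_apply, add_smul, Finset.sum_add_distrib]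
  rw [add_comm, Finset.sum_eq_single_of_mem t (Finset.mem_univ t) fun s _ hs => by
    rw [Pi.single_eq_of_ne hs, zero_smul], Pi.single_eq_same, one_smul]

variable {G} in
/-- The numbers of occurrences of the transitions in a path form a unit flow between its ends. -/
theorem Path.exists_flow {x y : Config d} {σ : List (Action d)} (h : G.Path x σ y) :
    ∃ μ : G.T → ℕ, (∀ z, G.outflow μ z + (if z = y then 1 else 0) =
      G.inflow μ z + if z = x then 1 else 0) ∧ G.displacement μ = σ.sum := by
  induction h with
  | nil x hx => exact ⟨0, fun z => by simp [outflow, inflow], by simp [displacement]⟩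
  | cons x a y σ z ht _ ih =>
    obtain ⟨μ, hμ, hd⟩ := ih
    refine ⟨μ + Pi.single ⟨_, ht⟩ 1, fun w => ?_, ?_⟩
    · have := hμ w
      rw [outflow_add_single, inflow_add_single]
      simp only
      omega
    · rw [displacement_add_single, hd, List.sum_cons]

variable {G} in
theorem IsReversible.exists_balanced (hrev : G.IsReversible) (t : G.T) :
    ∃ μ : G.T → ℕ, Balanced (fun t : G.T => t.1.1) (fun t : G.T => t.1.2.2) μ ∧ μ t ≠ 0 ∧
      G.displacement μ = 0 := by
  obtain ⟨⟨x, a, y⟩, ht⟩ := t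
  obtain ⟨v, hv, hsum⟩ := hrev x [a] y (.cons _ _ _ _ _ ht (.nil _ (G.T_subset _ ht).2.2))
  obtain ⟨μ, hμ, hd⟩ := hv.exists_flow
  refine ⟨μ + Pi.single ⟨_, ht⟩ 1, fun z => ?_, by simp, ?_⟩
  · change G.inflow _ z = G.outflow _ z
    have := hμ z
    rw [outflow_add_single, inflow_add_single]
    simp only
    omega
  · rw [displacement_add_single, hd]
    simpa using hsum

theorem abs_displacement_indicator_le {P : Finset G.T}
    (hP : IsCycleUnion (fun t : G.T => t.1.1) (fun t : G.T => t.1.2.2) P) (i : Fin d) :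
    |G.displacement (fun t => if t ∈ P then 1 else 0) i| ≤ (G.Q.card * setNorm A : ℕ) := by
  have hcard : P.card ≤ G.Q.card :=
    Finset.card_le_card_of_injOn _ (fun t _ => (G.T_subset _ t.2).1) hP.2
  have heq : G.displacement (fun t => if t ∈ P then 1 else 0) i = ∑ t ∈ P, t.1.2.1 i := by
    simp only [displacement, ite_smul, one_smul, zero_smul]
    rw [Finset.sum_ite_mem, Finset.univ_inter, Finset.sum_apply]
  rw [heq]
  calc |∑ t ∈ P, t.1.2.1 i| ≤ ∑ t ∈ P, |t.1.2.1 i| := Finset.abs_sum_le_sum_abs _ _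
    _ ≤ P.card • (setNorm A : ℤ) := Finset.sum_le_card_nsmul _ _ _ fun t _ => by
        have := natAbs_le_setNorm (G.T_subset _ t.2).2.1 i
        rw [Int.abs_eq_natAbs]
        exact_mod_cast this
    _ ≤ _ := by
        rw [nsmul_eq_mul, Nat.cast_mul]
        exact mul_le_mul_of_nonneg_right (by exact_mod_cast hcard) (by positivity)

variable {G} in
theorem IsReversible.exists_small_balanced (hrev : G.IsReversible) (hA : 1 ≤ setNorm A)
    (t : G.T) :
    ∃ μ : G.T → ℕ, Balanced (fun t : G.T => t.1.1) (fun t : G.T => t.1.2.2) μ ∧ μ t ≠ 0 ∧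
      G.displacement μ = 0 ∧
      ∀ e, μ e ≤ (d + 1) * (d.factorial * (G.Q.card * setNorm A) ^ d) := by
  obtain ⟨μ, hbal, hμt, hd⟩ := hrev.exists_balanced t
  obtain ⟨n, hn, hsum⟩ := hbal.exists_decomposition
  have hdisp : ∀ m : Finset G.T → ℕ,
      G.displacement (fun e => ∑ P, m P * if e ∈ P then 1 else 0) =
        ∑ P, m P • G.displacement fun e => if e ∈ P then 1 else 0 := fun m => by
    rw [displacement_sum]
    exact Finset.sum_congr rfl fun P _ => displacement_const_mul _ _ _
  obtain ⟨P₀, hP₀, htP₀⟩ : ∃ P, n P ≠ 0 ∧ t ∈ P := by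
    by_contra! hcon
    refine hμt ((hsum t).trans (Finset.sum_eq_zero fun P _ => ?_))
    by_cases hP : n P = 0
    · rw [hP, zero_mul]
    · rw [if_neg (hcon P hP), mul_zero]
  obtain ⟨m, hm₀, hmn, hmrel, hmle⟩ := exists_small_relation
    (fun P : Finset G.T => G.displacement fun e => if e ∈ P then 1 else 0)
    (G.Q.card * setNorm A) (Nat.mul_pos G.Q_nonempty.card_pos hA) P₀ n
    (fun P hP => G.abs_displacement_indicator_le (hn P hP)) hP₀
    (by rw [← hdisp, ← funext hsum, hd])
  refine ⟨fun e => ∑ P, m P * if e ∈ P then 1 else 0, Balanced.sum _ _ fun P _ => ?_,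
    fun h => hm₀ ?_, by rw [hdisp, hmrel], fun e => ?_⟩
  · by_cases hP : n P = 0
    · rw [hmn P hP]
      intro x
      simp
    · exact (hn P hP).1.const_mul _
  · have := Finset.sum_eq_zero_iff.1 h P₀ (Finset.mem_univ _)
    simpa [htP₀] using this
  · refine (Finset.sum_le_sum fun P _ => ?_).trans hmle
    split_ifs <;> simp

/-- If all actions are zero, all transitions are loops, and the constant function `1` has the
required properties. -/
theorem exists_total_of_setNorm_eq_zero (hA : setNorm A = 0) :
    ∃ μ : G.T → ℕ, G.IsKirchhoff μ ∧ G.IsTotal μ ∧ G.displacement μ = 0 ∧ G.funNorm μ ≤ 1 := by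
  have hzero : ∀ t : G.T, t.1.2.1 = 0 := fun t => by
    ext i
    have := natAbs_le_setNorm (G.T_subset _ t.2).2.1 i
    simp only [Pi.zero_apply]
    omega
  have hloop : ∀ t : G.T, t.1.2.2 = t.1.1 := fun t => by
    refine Config.toProjVec_injective ((G.T_step _ t.2).2.trans ?_)
    rw [hzero t]
    ext1 i
    by_cases hi : t.1.1 i = ⊤
    · simp [Config.toProjVec, hi]
    · simp [proj, Config.stars, hi]
  refine ⟨fun _ => 1, fun x _ => ?_, fun _ => le_rfl, ?_, Finset.sup_le fun _ _ => le_rfl⟩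
  · simp only [inflow, outflow, hloop]
  · exact Finset.sum_eq_zero fun t _ => by rw [hzero t, smul_zero]

end SubreachabilityGraph

end VAS

theorem mainTheorem6 (d : ℕ) (A : Finset (VAS.Action d)) (G : VAS.SubreachabilityGraph A)
    (hG : G.IsWitness) (hrev : G.IsReversible) :
    ∃ μ : G.T → ℕ, G.IsKirchhoff μ ∧ G.IsTotal μ ∧ G.displacement μ = 0 ∧
      G.funNorm μ ≤ (G.Q.card * (1 + 2 * VAS.setNorm A)) ^ (d * (d + 1)) := by
  have hq : 1 ≤ G.Q.card := G.Q_nonempty.card_pos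
  rcases Nat.eq_zero_or_pos (VAS.setNorm A) with hA | hA
  · obtain ⟨μ, h1, h2, h3, h4⟩ := G.exists_total_of_setNorm_eq_zero hA
    exact ⟨μ, h1, h2, h3, h4.trans (Nat.one_le_pow _ _ (by positivity))⟩
  have hd : 1 ≤ d := by
    by_contra h
    obtain rfl : d = 0 := by omega
    refine hA.ne' (Nat.eq_zero_of_le_zero (Finset.sup_le fun a _ => ?_))
    simp [VAS.vecNorm]
  choose μ hbal hpos hdisp hle using fun t => hrev.exists_small_balanced hA t
  refine ⟨fun e => ∑ t, μ t e, G.isKirchhoff_of_balanced (VAS.Balanced.sum _ _ fun t _ => hbal t),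
    fun t => ?_, ?_, Finset.sup_le fun e _ => ?_⟩
  · exact (Nat.one_le_iff_ne_zero.2 (hpos t)).trans
      (Finset.single_le_sum (f := fun s => μ s t) (fun _ _ => Nat.zero_le _) (Finset.mem_univ t))
  · rw [G.displacement_sum, Finset.sum_eq_zero fun t _ => hdisp t]
  · refine (Finset.sum_le_card_nsmul _ _ _ fun t _ => hle t e).trans
      (le_trans ?_ (VAS.factorial_succ_mul_pow_le hd hq))
    rw [smul_eq_mul, Finset.card_univ, Fintype.card_coe]
    exact Nat.mul_le_mul_right _ G.card_T_le
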